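/- Let $\mathbb F$ be a field and let $0\neq q\in\mathbb F$ be not a root of unity. For $X,Y$ in an $\mathbb F$-algebra put $[X,Y]=XY-YX$ and $[X,Y]_q=qXY-q^{-1}YX$. Let $\mathcal O_q$ be the $q$-Onsager algebra, that is, the associative unital $\mathbb F$-algebra with generators $A,A^*$ and relations $$[A,[A,[A,A^*]_q]_{q^{-1}}]=(q^2-q^{-2})^2[A^*,A],\qquad [A^*,[A^*,[A^*,A]_q]_{q^{-1}}]=(q^2-q^{-2})^2[A,A^*].$$ Let $L$ be the Lusztig automorphism of $\mathcal O_q$, that is, the algebra automorphism with $$L(A)=A,\qquad L(A^*)=A^*+\frac{[A,[A,A^*]_q]}{(q-q^{-1})(q^2-q^{-2})}.$$ Let $V$ be an irreducible $\mathcal O_q$-module of finite dimension at least $2$ on which each of $A$, $A^*$ is diagonalizable. Call $\lambda,\mu\in\mathbb F$ adjacent if $\lambda\neq\mu$ and $\lambda^2-(q^2+q^{-2})\lambda\mu+\mu^2+(q^2-q^{-2})^2=0$. Then the distinct eigenvalues of $A$ on $V$ can be ordered as $\theta_0,\ldots,\theta_d$ with $\theta_{i-1},\theta_i$ adjacent for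 $1\le i\le d$. Moreover, for every such ordering the following holds. For $0\le i\le d$ let $E_i\in\mathrm{End}(V)$ be the projection onto the $\theta_i$-eigenspace of $A$ along the sum of the other eigenspaces of $A$. For $0\le i,j\le d$ put $$t_{ij}=1+\frac{\theta_i-\theta_j}{q-q^{-1}}\,\frac{q\theta_i-q^{-1}\theta_j}{q^2-q^{-2}},$$ and put $$t_i=t_{01}t_{12}\cdots t_{i-1,i}\quad(0\le i\le d,\ t_0=1),\qquad H=\sum_{i=0}^d t_iE_i .$$ Then $H$ is invertible, and for every $X\in\mathcal O_q$ the following hold on $V$: $$L(X)=H^{-1}XH,\qquad L^{-1}(X)=HXH^{-1}.$$ -/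

import Mathlib

set_option linter.unusedSimpArgs false

/-! ### The `q`-Onsager algebra -/

namespace QOnsager

/-- The `q`-commutator `[X, Y]_q = q X Y - q⁻¹ Y X`. -/
def qComm {F R : Type*} [Field F] [Ring R] [Algebra F R] (q : F) (X Y : R) : R :=
  q • (X * Y) - q⁻¹ • (Y * X)

/-- The two generators `A` and `A*`. -/
inductive Gen : Type
  | A : Gen
  | Astar : Gen

/-- The `q`-Dolan/Grady relation
`[X, [X, [X, Y]_q]_{q⁻¹}] = (q² - q⁻²)² [Y, X]`; here `⁅X, Y⁆ = X Y - Y X`. -/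
def DolanGrady {F R : Type*} [Field F] [Ring R] [Algebra F R] (q : F) (X Y : R) : Prop :=
  ⁅X, qComm q⁻¹ X (qComm q X Y)⁆ = (q ^ 2 - q⁻¹ ^ 2) ^ 2 • ⁅Y, X⁆

/-- The defining relations of the `q`-Onsager algebra, as a relation on the free algebra
on the two generators. -/
inductive Rel {F : Type*} [Field F] (q : F) : FreeAlgebra F Gen → FreeAlgebra F Gen → Prop
  | dg (i j : Gen) (hij : i ≠ j) :
      Rel q
        ⁅FreeAlgebra.ι F i, qComm q⁻¹ (FreeAlgebra.ι F i)
          (qComm q (FreeAlgebra.ι F i) (FreeAlgebra.ι F j))⁆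
        ((q ^ 2 - q⁻¹ ^ 2) ^ 2 • ⁅FreeAlgebra.ι F j, FreeAlgebra.ι F i⁆)

/-- The `q`-Onsager algebra: generators `A`, `A*`, and the two `q`-Dolan/Grady relations. -/
abbrev Oq {F : Type*} [Field F] (q : F) : Type _ := RingQuot (Rel q)

/-- The image of a generator in the `q`-Onsager algebra. -/
def gen {F : Type*} [Field F] (q : F) (i : Gen) : Oq q :=
  RingQuot.mkAlgHom F (Rel q) (FreeAlgebra.ι F i)

/-- The generator `A`. -/
abbrev genA {F : Type*} [Field F] (q : F) : Oq q := gen q Gen.A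

/-- The generator `A*`. -/
abbrev genAstar {F : Type*} [Field F] (q : F) : Oq q := gen q Gen.Astar

theorem dolanGrady_gen {F : Type*} [Field F] (q : F) (i j : Gen) (hij : i ≠ j) :
    DolanGrady q (gen q i) (gen q j) := by
  have h := RingQuot.mkAlgHom_rel F (Rel.dg (q := q) i j hij)
  simpa [DolanGrady, qComm, gen, Ring.lie_def] using h

/-- The algebra homomorphism out of the `q`-Onsager algebra determined by two elements that
satisfy the `q`-Dolan/Grady relations. -/
def lift {F R : Type*} [Field F] [Ring R] [Algebra F R] (q : F) (X Y : R)
    (h1 : DolanGrady q X Y) (h2 : DolanGrady q Y X) : Oq q →ₐ[F] R :=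
  RingQuot.liftAlgHom F ⟨FreeAlgebra.lift F (fun i => Gen.casesOn i X Y), by
    intro x y hxy
    obtain ⟨i, j, hij⟩ := hxy
    cases i <;> cases j
    · exact absurd rfl hij
    · simpa [DolanGrady, qComm, Ring.lie_def] using h1
    · simpa [DolanGrady, qComm, Ring.lie_def] using h2
    · exact absurd rfl hij⟩

theorem lift_genA {F R : Type*} [Field F] [Ring R] [Algebra F R] (q : F) (X Y : R)
    (h1 : DolanGrady q X Y) (h2 : DolanGrady q Y X) : lift q X Y h1 h2 (genA q) = X := by
  simp [lift, gen]

theorem lift_genAstar {F R : Type*} [Field F] [Ring R] [Algebra F R] (q : F) (X Y : R)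
    (h1 : DolanGrady q X Y) (h2 : DolanGrady q Y X) : lift q X Y h1 h2 (genAstar q) = Y := by
  simp [lift, gen]

theorem algHom_ext {F R : Type*} [Field F] [Ring R] [Algebra F R] {q : F}
    {f g : Oq q →ₐ[F] R} (hA : f (genA q) = g (genA q))
    (hB : f (genAstar q) = g (genAstar q)) : f = g := by
  apply RingQuot.ringQuot_ext'
  apply FreeAlgebra.hom_ext
  funext i
  cases i
  · simpa [gen] using hA
  · simpa [gen] using hB

/-! ### The Lusztig automorphism -/

/-- The scalar `(q - q⁻¹)(q² - q⁻²)`. -/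
def lusztigScalar {F : Type*} [Field F] (q : F) : F := (q - q⁻¹) * (q ^ 2 - q⁻¹ ^ 2)

/-- The expression `Y + [X, [X, Y]_q] / ((q - q⁻¹)(q² - q⁻²))`. -/
def lusztigImage {F R : Type*} [Field F] [Ring R] [Algebra F R] (q : F) (X Y : R) : R :=
  Y + (lusztigScalar q)⁻¹ • ⁅X, qComm q X Y⁆

/-- Left-hand side minus right-hand side of the expanded `q`-Dolan/Grady relation. -/
def dg {F R : Type*} [Field F] [Ring R] [Algebra F R] (q : F) (X Y : R) : R :=
  X * X * X * Y - (q ^ 2 + 1 + q⁻¹ ^ 2) • (X * X * Y * X) + (q ^ 2 + 1 + q⁻¹ ^ 2) • (X * Y * X * X)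
    - Y * X * X * X - (q ^ 2 - q⁻¹ ^ 2) ^ 2 • (Y * X - X * Y)

theorem dolanGrady_iff {F R : Type*} [Field F] [Ring R] [Algebra F R] {q : F} (hq : q ≠ 0)
    (X Y : R) : DolanGrady q X Y ↔ dg q X Y = 0 := by
  have : ⁅X, qComm q⁻¹ X (qComm q X Y)⁆ - (q ^ 2 - q⁻¹ ^ 2) ^ 2 • ⁅Y, X⁆ = dg q X Y := by
    simp only [dg, qComm, Ring.lie_def, mul_add, add_mul, mul_sub, sub_mul, mul_assoc,
      smul_mul_assoc, mul_smul_comm, smul_add, smul_sub]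
    match_scalars <;> field_simp <;> ring
  rw [DolanGrady, ← sub_eq_zero, this]

theorem dg_inv {F R : Type*} [Field F] [Ring R] [Algebra F R] (q : F) (X Y : R) :
    dg q⁻¹ X Y = dg q X Y := by
  simp only [dg, inv_inv]
  match_scalars <;> ring

/-- The multiple `c Y + [X, [X, Y]_q]` of the expression `lusztigImage`. -/
def twist {F R : Type*} [Field F] [Ring R] [Algebra F R] (q : F) (X Y : R) : R :=
  lusztigScalar q • Y + ⁅X, qComm q X Y⁆

theorem dg_twist {F R : Type*} [Field F] [Ring R] [Algebra F R] {q : F} (hq : q ≠ 0) (X Y : R)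
    (h : dg q X Y = 0) : dg q X (twist q X Y) = 0 := by
  have key : dg q X (twist q X Y) = lusztigScalar q • dg q X Y + ⁅X, qComm q X (dg q X Y)⁆ := by
    simp only [twist, dg, qComm, Ring.lie_def, lusztigScalar, mul_add, add_mul, mul_sub, sub_mul,
      mul_assoc, smul_mul_assoc, mul_smul_comm, smul_add, smul_sub]
    match_scalars <;> field_simp <;> ring
  rw [key, h]; simp [qComm, Ring.lie_def]

theorem qComm_twist {F R : Type*} [Field F] [Ring R] [Algebra F R] {q : F} (hq : q ≠ 0) (X Y : R)
    (h : dg q X Y = 0) : qComm q (twist q X Y) X = lusztigScalar q • qComm q X Y := by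
  have key : qComm q (twist q X Y) X - lusztigScalar q • qComm q X Y = - dg q X Y := by
    simp only [twist, dg, qComm, Ring.lie_def, lusztigScalar, mul_add, add_mul, mul_sub, sub_mul,
      mul_assoc, smul_mul_assoc, mul_smul_comm, smul_add, smul_sub]
    match_scalars <;> field_simp <;> ring
  rw [h, neg_zero, sub_eq_zero] at key; exact key

theorem twist_twist {F R : Type*} [Field F] [Ring R] [Algebra F R] {q : F} (hq : q ≠ 0) (X Y : R)
    (h : dg q X Y = 0) : twist q⁻¹ X (twist q X Y) = lusztigScalar q ^ 2 • Y := by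
  have key : twist q⁻¹ X (twist q X Y) - lusztigScalar q ^ 2 • Y
      = X * dg q X Y - dg q X Y * X := by
    simp only [twist, dg, qComm, Ring.lie_def, lusztigScalar, mul_add, add_mul, mul_sub, sub_mul,
      mul_assoc, smul_mul_assoc, mul_smul_comm, smul_add, smul_sub]
    match_scalars <;> field_simp <;> ring
  rw [h, mul_zero, zero_mul, sub_zero, sub_eq_zero] at key; exact key

theorem twist_mul_twist {F R : Type*} [Field F] [Ring R] [Algebra F R] {q : F} (hq : q ≠ 0)
    (X Z W : R) (hZ : dg q X Z = 0) (hW : dg q X W = 0) :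
    ((q ^ 4 + q ^ 2 + 1) * (q ^ 4 + 1)) • (twist q X Z * twist q X W) =
      ((q ^ 4 + q ^ 2 + 1) * (q ^ 4 + 1) * lusztigScalar q ^ 2) • (Z * W)
      + ((q ^ 4 - 1) * (q ^ 2 - 1) * (q ^ 8 + q ^ 6 + 3 * q ^ 4 + 2 * q ^ 2 + 1) * q⁻¹ ^ 4) •
          (Z * W * X * X)
      - ((q ^ 4 - 1) ^ 2 * (q ^ 2 + 1) ^ 2 * q⁻¹ ^ 4 * (q ^ 4 + 1)) • (X * Z * W * X)
      + ((q ^ 4 - 1) * (q ^ 2 - 1) * (q ^ 8 + 2 * q ^ 6 + 3 * q ^ 4 + q ^ 2 + 1) * q⁻¹ ^ 2) •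
          (X * X * Z * W)
      + q ^ 2 • (Z * W * X * X * X * X)
      - ((q ^ 2 + 1) * (q ^ 4 + 1)) • (X * Z * W * X * X * X)
      + ((q ^ 4 + q ^ 2 + 1) * (q ^ 4 + 1)) • (X * X * Z * W * X * X)
      - (q ^ 2 * (q ^ 2 + 1) * (q ^ 4 + 1)) • (X * X * X * Z * W * X)
      + q ^ 6 • (X * X * X * X * Z * W) := by
  rw [← sub_eq_zero]
  trans - q ^ 6 • (X * dg q X Z * W) - (q ^ 4 * (q ^ 4 + q ^ 2 + 1)) • (dg q X Z * X * W)
      + (q ^ 2 * (q ^ 2 + 1) * (q ^ 4 + 1)) • (dg q X Z * W * X)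
      - ((q ^ 2 + 1) * (q ^ 4 + 1)) • (X * Z * dg q X W)
      + (q ^ 4 + q ^ 2 + 1) • (Z * X * dg q X W) + q ^ 2 • (Z * dg q X W * X)
  · simp only [twist, dg, qComm, Ring.lie_def, lusztigScalar, mul_add, add_mul, mul_sub, sub_mul,
      mul_assoc, smul_mul_assoc, mul_smul_comm, smul_add, smul_sub]
    match_scalars <;> field_simp <;> ring
  · simp [hZ, hW]

/-- If `Z`, `W` commute and satisfy the cubic relation with `X`, their twists commute. -/
theorem twist_commute {F R : Type*} [Field F] [Ring R] [Algebra F R] {q : F} (hq : q ≠ 0)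
    (hroot : ∀ n : ℕ, 0 < n → q ^ n ≠ 1)
    (X Z W : R) (hZ : dg q X Z = 0) (hW : dg q X W = 0) (hZW : Z * W = W * Z) :
    twist q X Z * twist q X W = twist q X W * twist q X Z := by
  have h1 := twist_mul_twist hq X Z W hZ hW
  have h2 := twist_mul_twist hq X W Z hW hZ
  have hD : ((q ^ 4 + q ^ 2 + 1) * (q ^ 4 + 1)) ≠ 0 := by
    intro h
    rcases mul_eq_zero.mp h with h | h
    · exact hroot 6 (by norm_num) (by linear_combination (q ^ 2 - 1) * h)
    · exact hroot 8 (by norm_num) (by linear_combination (q ^ 4 - 1) * h)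
  have h3 : ((q ^ 4 + q ^ 2 + 1) * (q ^ 4 + 1)) • (twist q X Z * twist q X W) =
      ((q ^ 4 + q ^ 2 + 1) * (q ^ 4 + 1)) • (twist q X W * twist q X Z) := by
    rw [h1, h2]
    simp only [mul_assoc]
    have h4 : ∀ T : R, Z * (W * T) = W * (Z * T) := fun T => by
      rw [← mul_assoc, hZW, mul_assoc]
    simp only [h4, hZW]
  exact smul_right_injective R hD h3

/-- The second auxiliary element, `[Y, [X, Y]_q]_q - (q² - q⁻²)² X`. -/
def aux {F R : Type*} [Field F] [Ring R] [Algebra F R] (q : F) (X Y : R) : R :=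
  qComm q Y (qComm q X Y) - (q ^ 2 - q⁻¹ ^ 2) ^ 2 • X

theorem dg_aux {F R : Type*} [Field F] [Ring R] [Algebra F R] {q : F} (hq : q ≠ 0) (X Y : R)
    (h : dg q X Y = 0) : dg q X (aux q X Y) = 0 := by
  trans - (X * dg q X Y * Y) - dg q X Y * X * Y + (q ^ 2 + q⁻¹ ^ 2) • (dg q X Y * Y * X)
      + (q ^ 2 + q⁻¹ ^ 2) • (X * Y * dg q X Y) - Y * X * dg q X Y - Y * dg q X Y * X
  · simp only [aux, dg, qComm, mul_add, add_mul, mul_sub, sub_mul,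
      mul_assoc, smul_mul_assoc, mul_smul_comm, smul_add, smul_sub]
    match_scalars <;> field_simp <;> ring
  · simp [h]

theorem twist_aux {F R : Type*} [Field F] [Ring R] [Algebra F R] {q : F} (hq : q ≠ 0) (X Y : R)
    (h : dg q X Y = 0) :
    twist q X (aux q X Y) =
      qComm q (qComm q X Y) (twist q X Y) - (lusztigScalar q * (q ^ 2 - q⁻¹ ^ 2) ^ 2) • X := by
  rw [← sub_eq_zero]
  trans - q • (dg q X Y * Y) + q⁻¹ • (Y * dg q X Y)
  · simp only [twist, aux, dg, qComm, Ring.lie_def, lusztigScalar, mul_add, add_mul, mul_sub,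
      sub_mul, mul_assoc, smul_mul_assoc, mul_smul_comm, smul_add, smul_sub]
    match_scalars <;> field_simp <;> ring
  · simp [h]

theorem lusztigScalar_ne_zero {F : Type*} [Field F] {q : F} (hq : q ≠ 0)
    (hroot : ∀ n : ℕ, 0 < n → q ^ n ≠ 1) : lusztigScalar q ≠ 0 := by
  intro h
  rcases mul_eq_zero.mp h with h | h
  · apply hroot 2 (by norm_num)
    field_simp at h; linear_combination h
  · apply hroot 4 (by norm_num)
    field_simp at h; linear_combination h

theorem lusztigImage_eq {F R : Type*} [Field F] [Ring R] [Algebra F R] {q : F} (hq : q ≠ 0)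
    (hroot : ∀ n : ℕ, 0 < n → q ^ n ≠ 1) (X Y : R) :
    lusztigImage q X Y = (lusztigScalar q)⁻¹ • twist q X Y := by
  rw [lusztigImage, twist, smul_add, smul_smul, inv_mul_cancel₀ (lusztigScalar_ne_zero hq hroot),
    one_smul]

theorem dg_smul {F R : Type*} [Field F] [Ring R] [Algebra F R] (q r : F) (X Y : R) :
    dg q X (r • Y) = r • dg q X Y := by
  simp only [dg, smul_mul_assoc, mul_smul_comm, smul_add, smul_sub]
  match_scalars <;> ring

/-- The pair `X`, `lusztigImage q X Y` satisfies the first `q`-Dolan/Grady relation. -/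
theorem dolanGrady_lusztigImage {F R : Type*} [Field F] [Ring R] [Algebra F R] {q : F}
    (hq : q ≠ 0) (hroot : ∀ n : ℕ, 0 < n → q ^ n ≠ 1) (X Y : R) (h1 : DolanGrady q X Y) :
    DolanGrady q X (lusztigImage q X Y) := by
  rw [dolanGrady_iff hq] at h1 ⊢
  rw [lusztigImage_eq hq hroot, dg_smul, dg_twist hq X Y h1, smul_zero]

/-- The pair `lusztigImage q X Y`, `X` satisfies the second `q`-Dolan/Grady relation. -/
theorem dolanGrady_lusztigImage' {F R : Type*} [Field F] [Ring R] [Algebra F R] {q : F}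
    (hq : q ≠ 0) (hroot : ∀ n : ℕ, 0 < n → q ^ n ≠ 1) (X Y : R) (h1 : DolanGrady q X Y)
    (h2 : DolanGrady q Y X) : DolanGrady q (lusztigImage q X Y) X := by
  have hc := lusztigScalar_ne_zero hq hroot
  rw [dolanGrady_iff hq] at h1
  have hYU : Y * aux q X Y = aux q X Y * Y := by
    rw [dolanGrady_iff hq] at h2
    rw [← sub_eq_zero]
    trans - dg q Y X
    · simp only [aux, dg, qComm, mul_add, add_mul, mul_sub, sub_mul,
        mul_assoc, smul_mul_assoc, mul_smul_comm, smul_add, smul_sub]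
      match_scalars <;> field_simp <;> ring
    · rw [h2, neg_zero]
  have hcomm := twist_commute hq hroot X Y (aux q X Y) h1 (dg_aux hq X Y h1) hYU
  rw [twist_aux hq X Y h1] at hcomm
  have hB := qComm_twist hq X Y h1
  rw [lusztigImage_eq hq hroot, DolanGrady]
  generalize twist q X Y = T at *
  have hB' : qComm q ((lusztigScalar q)⁻¹ • T) X = qComm q X Y := by
    have : qComm q ((lusztigScalar q)⁻¹ • T) X = (lusztigScalar q)⁻¹ • qComm q T X := by
      simp only [qComm, smul_mul_assoc, mul_smul_comm, smul_sub]
      match_scalars <;> ring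
    rw [this, hB, smul_smul, inv_mul_cancel₀ hc, one_smul]
  rw [hB']
  generalize qComm q X Y = B at *
  generalize lusztigScalar q = c at *
  rw [← sub_eq_zero] at hcomm ⊢
  trans - (c⁻¹ ^ 2) • (T * (qComm q B T - (c * (q ^ 2 - q⁻¹ ^ 2) ^ 2) • X) -
    (qComm q B T - (c * (q ^ 2 - q⁻¹ ^ 2) ^ 2) • X) * T)
  · simp only [qComm, Ring.lie_def, mul_add, add_mul, mul_sub, sub_mul,
      mul_assoc, smul_mul_assoc, mul_smul_comm, smul_add, smul_sub]
    match_scalars <;> field_simp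
  · rw [hcomm, smul_zero]

theorem lusztigScalar_inv {F : Type*} [Field F] (q : F) : lusztigScalar q⁻¹ = lusztigScalar q := by
  simp only [lusztigScalar, inv_inv]; ring

theorem dolanGrady_inv {F R : Type*} [Field F] [Ring R] [Algebra F R] {q : F} (hq : q ≠ 0)
    (X Y : R) : DolanGrady q⁻¹ X Y ↔ DolanGrady q X Y := by
  rw [dolanGrady_iff hq, dolanGrady_iff (inv_ne_zero hq), dg_inv]

theorem inv_not_root {F : Type*} [Field F] {q : F} (hroot : ∀ n : ℕ, 0 < n → q ^ n ≠ 1) :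
    ∀ n : ℕ, 0 < n → q⁻¹ ^ n ≠ 1 := by
  intro n hn h
  rw [inv_pow, inv_eq_one] at h
  exact hroot n hn h

theorem lusztigImage_lusztigImage {F R : Type*} [Field F] [Ring R] [Algebra F R] {q : F}
    (hq : q ≠ 0) (hroot : ∀ n : ℕ, 0 < n → q ^ n ≠ 1) (X Y : R) (h1 : DolanGrady q X Y) :
    lusztigImage q⁻¹ X (lusztigImage q X Y) = Y := by
  have hc := lusztigScalar_ne_zero hq hroot
  have h := twist_twist hq X Y ((dolanGrady_iff hq X Y).mp h1)
  rw [lusztigImage_eq (inv_ne_zero hq) (inv_not_root hroot), lusztigImage_eq hq hroot,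
    lusztigScalar_inv]
  have h' : twist q⁻¹ X ((lusztigScalar q)⁻¹ • twist q X Y)
      = (lusztigScalar q)⁻¹ • twist q⁻¹ X (twist q X Y) := by
    generalize twist q X Y = T
    simp only [twist, qComm, Ring.lie_def, smul_mul_assoc, mul_smul_comm, smul_add, smul_sub,
      mul_sub, sub_mul]
    match_scalars <;> ring
  rw [h', h, smul_smul, smul_smul]
  have : (lusztigScalar q)⁻¹ * ((lusztigScalar q)⁻¹ * lusztigScalar q ^ 2) = 1 := by field_simp
  rw [mul_assoc] at *
  rw [this, one_smul]

/-- The homomorphism with `A ↦ A` and `A* ↦ A* + [A, [A, A*]_q] / ((q - q⁻¹)(q² - q⁻²))`. -/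
def lusztigHom {F : Type*} [Field F] (q : F) (hq : q ≠ 0)
    (hroot : ∀ n : ℕ, 0 < n → q ^ n ≠ 1) : Oq q →ₐ[F] Oq q :=
  lift q (genA q) (lusztigImage q (genA q) (genAstar q))
    (dolanGrady_lusztigImage hq hroot _ _ (dolanGrady_gen q _ _ (by simp)))
    (dolanGrady_lusztigImage' hq hroot _ _ (dolanGrady_gen q _ _ (by simp))
      (dolanGrady_gen q _ _ (by simp)))

/-- The homomorphism with `A ↦ A` and `A* ↦ A* + [A, [A, A*]_{q⁻¹}] / ((q - q⁻¹)(q² - q⁻²))`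
(the scalar `lusztigScalar` is unchanged when `q` is replaced by `q⁻¹`). -/
def lusztigInvHom {F : Type*} [Field F] (q : F) (hq : q ≠ 0)
    (hroot : ∀ n : ℕ, 0 < n → q ^ n ≠ 1) : Oq q →ₐ[F] Oq q :=
  lift q (genA q) (lusztigImage q⁻¹ (genA q) (genAstar q))
    ((dolanGrady_inv hq _ _).mp (dolanGrady_lusztigImage (inv_ne_zero hq) (inv_not_root hroot) _ _
      ((dolanGrady_inv hq _ _).mpr (dolanGrady_gen q _ _ (by simp)))))
    ((dolanGrady_inv hq _ _).mp (dolanGrady_lusztigImage' (inv_ne_zero hq) (inv_not_root hroot) _ _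
      ((dolanGrady_inv hq _ _).mpr (dolanGrady_gen q _ _ (by simp)))
      ((dolanGrady_inv hq _ _).mpr (dolanGrady_gen q _ _ (by simp)))))

theorem map_lusztigImage {F R S : Type*} [Field F] [Ring R] [Algebra F R] [Ring S] [Algebra F S]
    (f : R →ₐ[F] S) (q : F) (X Y : R) :
    f (lusztigImage q X Y) = lusztigImage q (f X) (f Y) := by
  simp [lusztigImage, qComm, Ring.lie_def]

/-- The Lusztig automorphism `L` of the `q`-Onsager algebra. -/
def lusztig {F : Type*} [Field F] (q : F) (hq : q ≠ 0)
    (hroot : ∀ n : ℕ, 0 < n → q ^ n ≠ 1) : Oq q ≃ₐ[F] Oq q :=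
  AlgEquiv.ofAlgHom (lusztigHom q hq hroot) (lusztigInvHom q hq hroot)
    (by
      apply algHom_ext
      · simp [lusztigHom, lusztigInvHom, lift_genA]
      · have h := lusztigImage_lusztigImage hq hroot (genA q)
          (genAstar q) (dolanGrady_gen q _ _ (by simp))
        simpa [lusztigHom, lusztigInvHom, lift_genA, lift_genAstar, map_lusztigImage] using h)
    (by
      apply algHom_ext
      · simp [lusztigHom, lusztigInvHom, lift_genA]
      · have h := lusztigImage_lusztigImage (inv_ne_zero hq) (inv_not_root hroot) (genA q)
          (genAstar q) ((dolanGrady_inv hq _ _).mpr (dolanGrady_gen q _ _ (by simp)))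
        rw [inv_inv] at h
        simpa [lusztigHom, lusztigInvHom, lift_genA, lift_genAstar, map_lusztigImage] using h)

theorem lusztig_genA {F : Type*} [Field F] (q : F) (hq : q ≠ 0)
    (hroot : ∀ n : ℕ, 0 < n → q ^ n ≠ 1) : lusztig q hq hroot (genA q) = genA q := by
  simp [lusztig, lusztigHom, lift_genA]

theorem lusztig_genAstar {F : Type*} [Field F] (q : F) (hq : q ≠ 0)
    (hroot : ∀ n : ℕ, 0 < n → q ^ n ≠ 1) :
    lusztig q hq hroot (genAstar q) = genAstar q +
      ((q - q⁻¹) * (q ^ 2 - q⁻¹ ^ 2))⁻¹ • ⁅genA q, qComm q (genA q) (genAstar q)⁆ := by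
  simp [lusztig, lusztigHom, lift_genAstar, lusztigImage, lusztigScalar]

theorem lusztig_symm_genA {F : Type*} [Field F] (q : F) (hq : q ≠ 0)
    (hroot : ∀ n : ℕ, 0 < n → q ^ n ≠ 1) : (lusztig q hq hroot).symm (genA q) = genA q := by
  simp [lusztig, lusztigInvHom, lift_genA]

theorem lusztig_symm_genAstar {F : Type*} [Field F] (q : F) (hq : q ≠ 0)
    (hroot : ∀ n : ℕ, 0 < n → q ^ n ≠ 1) :
    (lusztig q hq hroot).symm (genAstar q) = genAstar q +
      ((q - q⁻¹) * (q ^ 2 - q⁻¹ ^ 2))⁻¹ • ⁅genA q, qComm q⁻¹ (genA q) (genAstar q)⁆ := by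
  rw [← lusztigScalar, ← lusztigScalar_inv]
  simp [lusztig, lusztigInvHom, lift_genAstar, lusztigImage]

/-! ### Modules, eigenspaces and the map `H` -/

/-- The action of the `q`-Onsager algebra on a module `V`, as an algebra homomorphism to
`End(V)`. -/
def act {F : Type*} [Field F] (q : F) (V : Type*) [AddCommGroup V] [Module F V]
    [Module (Oq q) V] [IsScalarTower F (Oq q) V] : Oq q →ₐ[F] Module.End F V :=
  Algebra.lsmul F F V

/-- A linear map is diagonalizable if `V` is spanned by its eigenspaces. -/
def IsDiagonalizable {F V : Type*} [Field F] [AddCommGroup V] [Module F V]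
    (T : Module.End F V) : Prop :=
  ⨆ μ : F, T.eigenspace μ = ⊤

theorem isCompl_eigenspace {F V : Type*} [Field F] [AddCommGroup V] [Module F V]
    {T : Module.End F V} (hT : IsDiagonalizable T) (μ : F) :
    IsCompl (T.eigenspace μ) (⨆ ν : F, ⨆ _ : ν ≠ μ, T.eigenspace ν) := by
  refine ⟨T.eigenspaces_iSupIndep μ, ?_⟩
  rw [codisjoint_iff, ← top_le_iff, ← hT]
  refine iSup_le fun ν => ?_
  by_cases h : ν = μ
  · subst h; exact le_sup_left
  · exact le_sup_of_le_right (le_iSup₂_of_le ν h le_rfl)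

/-- For diagonalizable `T`, the projection `E_μ` of `V` onto the `μ`-eigenspace of `T`,
along the sum of the other eigenspaces. -/
noncomputable def eigenProj {F V : Type*} [Field F] [AddCommGroup V] [Module F V]
    {T : Module.End F V} (hT : IsDiagonalizable T) (μ : F) : Module.End F V :=
  Submodule.projection _ _ (isCompl_eigenspace hT μ)

/-- Distinct scalars `x`, `y` are adjacent if
`P(x, y) = x² - (q² + q⁻²) x y + y² + (q² - q⁻²)²` vanishes. -/
def Adjacent {F : Type*} [Field F] (q x y : F) : Prop :=
  x ≠ y ∧ x ^ 2 - (q ^ 2 + q⁻¹ ^ 2) * x * y + y ^ 2 + (q ^ 2 - q⁻¹ ^ 2) ^ 2 = 0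

/-- `θ 0, …, θ d` is an ordering of the (mutually distinct) eigenvalues of `T` such that
consecutive entries are adjacent. -/
structure IsEigenvalueOrdering {F V : Type*} [Field F] [AddCommGroup V] [Module F V] (q : F)
    (T : Module.End F V) {d : ℕ} (θ : Fin (d + 1) → F) : Prop where
  injective : Function.Injective θ
  range_eq : Set.range θ = {μ : F | T.HasEigenvalue μ}
  adjacent : ∀ i : Fin d, Adjacent q (θ i.castSucc) (θ i.succ)

/-- The scalar `t_{ij}`, as a function of `x = θ_i` and `y = θ_j`. -/
def tPair {F : Type*} [Field F] (q x y : F) : F :=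
  1 + (x - y) / (q - q⁻¹) * ((q * x - q⁻¹ * y) / (q ^ 2 - q⁻¹ ^ 2))

/-- The scalar `t_i = t_{01} t_{12} ⋯ t_{i-1,i}`. -/
def tProd {F : Type*} [Field F] (q : F) {d : ℕ} (θ : Fin (d + 1) → F) (i : Fin (d + 1)) : F :=
  ∏ j ∈ Finset.univ.filter (fun j : Fin d => (j : ℕ) < (i : ℕ)), tPair q (θ j.castSucc) (θ j.succ)

/-- The map `H = ∑ i, t_i E_i`. -/
noncomputable def mapH {F V : Type*} [Field F] [AddCommGroup V] [Module F V] (q : F)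
    {T : Module.End F V} (hT : IsDiagonalizable T) {d : ℕ} (θ : Fin (d + 1) → F) :
    Module.End F V :=
  ∑ i : Fin (d + 1), tProd q θ i • eigenProj hT (θ i)

end QOnsager

/-! Everything is read off from the blocks $E_\varphi Y E_\mu$ of an operator $Y$ with respect to
the eigenspaces of $A$. On such a block, left multiplication by $A$ is the scalar $\varphi$ and
right multiplication is $\mu$. The first $q$-Dolan/Grady relation therefore says that
$(\varphi-\mu)P(\varphi,\mu)$ kills the block of $A^*$, where $P$ is the adjacency polynomial. So
$A^*$ has only diagonal blocks and blocks between adjacent eigenvalues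
(`eigenProj_apply_eq_zero_of_dg`). In the same way $L$ multiplies the $(i,j)$ block of $A^*$ by
$t_{ij}$ (`eigenProj_lusztigImage_apply`). Hence $HL(A^*)=A^*H$ reduces to $t_it_{ij}=t_j$ for
$\theta_i,\theta_j$ adjacent.

For $j=i+1$ this is the definition of $t_j$; for $j=i-1$ it follows from $t_{ij}t_{ji}=1$
(`tPair_mul_tPair`). No other adjacent pairs occur. Since $P$ is quadratic, a scalar has at most two
neighbours, so an extra adjacency would close the path into a cycle. A cycle gives a periodic
solution of a linear recurrence with characteristic roots $q^{\pm2}$, which must vanish as $q$ is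
not a root of unity (`eq_add_one_of_adjacent`).

An ordering exists because irreducibility makes the adjacency graph on the eigenvalues connected
(`mem_of_adjacent_closed`), and a connected graph with degrees at most two and no cycle is a path.
-/

namespace QOnsager

/-! ### Eigenspace projections and blocks -/

section EigenProj

variable {F V : Type*} [Field F] [AddCommGroup V] [Module F V] {T : Module.End F V}

theorem eigenProj_apply_self (hT : IsDiagonalizable T) {μ : F} {v : V}
    (hv : v ∈ T.eigenspace μ) : eigenProj hT μ v = v :=
  Submodule.projection_apply_of_mem_left (isCompl_eigenspace hT μ) hv

theorem eigenProj_apply_of_ne (hT : IsDiagonalizable T) {μ ν : F} (h : ν ≠ μ) {v : V}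
    (hv : v ∈ T.eigenspace ν) : eigenProj hT μ v = 0 :=
  Submodule.projection_apply_of_mem_right (isCompl_eigenspace hT μ)
    (Submodule.mem_iSup_of_mem ν (Submodule.mem_iSup_of_mem h hv))

theorem eigenProj_mem (hT : IsDiagonalizable T) (μ : F) (v : V) :
    eigenProj hT μ v ∈ T.eigenspace μ :=
  Submodule.projection_apply_mem (isCompl_eigenspace hT μ) v

/-- Linear maps that agree on the eigenspaces of a diagonalizable map are equal. -/
theorem IsDiagonalizable.hom_ext (hT : IsDiagonalizable T) {f g : Module.End F V}
    (h : ∀ μ : F, ∀ v ∈ T.eigenspace μ, f v = g v) : f = g := by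
  ext x
  have hx : x ∈ ⨆ μ : F, T.eigenspace μ := by rw [hT]; trivial
  induction hx using Submodule.iSup_induction' with
  | mem μ v hv => exact h μ v hv
  | zero => simp
  | add x y _ _ hx hy => rw [map_add, map_add, hx, hy]

theorem eigenProj_apply_map (hT : IsDiagonalizable T) (μ : F) (v : V) :
    eigenProj hT μ (T v) = μ • eigenProj hT μ v := by
  have h : eigenProj hT μ * T = μ • eigenProj hT μ := by
    refine hT.hom_ext fun ν v hv => ?_
    rw [Module.End.mul_apply, Module.End.mem_eigenspace_iff.mp hv, map_smul, LinearMap.smul_apply]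
    by_cases hν : ν = μ
    · rw [hν]
    · rw [eigenProj_apply_of_ne hT hν hv, smul_zero, smul_zero]
  exact LinearMap.congr_fun h v

theorem hasEigenvalue_of_eigenProj_ne_zero (hT : IsDiagonalizable T) {μ : F} {v : V}
    (h : eigenProj hT μ v ≠ 0) : T.HasEigenvalue μ :=
  Module.End.hasEigenvalue_of_hasEigenvector ⟨eigenProj_mem hT μ v, h⟩

/-- A vector is a finite sum of eigenvectors for distinct eigenvalues, and $E_\mu$ picks out the
$\mu$-term. This allows vectors to be compared one component at a time. -/
theorem eq_zero_of_eigenProj_eq_zero (hT : IsDiagonalizable T) {x : V}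
    (h : ∀ μ : F, eigenProj hT μ x = 0) : x = 0 := by
  have hx : x ∈ ⨆ μ : F, T.eigenspace μ := by rw [hT]; trivial
  obtain ⟨f, hf, rfl⟩ := (Submodule.mem_iSup_iff_exists_finsupp _ _).mp hx
  refine Finset.sum_eq_zero fun μ hμ => ?_
  have h1 := h μ
  rw [Finsupp.sum, map_sum, Finset.sum_eq_single_of_mem μ hμ
    (fun ν _ hν => eigenProj_apply_of_ne hT hν (hf ν)), eigenProj_apply_self hT (hf μ)] at h1
  exact h1

theorem ext_eigenProj (hT : IsDiagonalizable T) {x y : V}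
    (h : ∀ μ : F, eigenProj hT μ x = eigenProj hT μ y) : x = y :=
  sub_eq_zero.mp (eq_zero_of_eigenProj_eq_zero hT fun μ => by rw [map_sub, h μ, sub_self])

theorem IsEigenvalueOrdering.mem_range {q : F} {d : ℕ} {θ : Fin (d + 1) → F}
    (hθ : IsEigenvalueOrdering q T θ) {μ : F} (hμ : T.HasEigenvalue μ) : ∃ i, θ i = μ := by
  have h : μ ∈ Set.range θ := by rw [hθ.range_eq]; exact hμ
  exact h

theorem IsEigenvalueOrdering.exists_eq {q : F} {d : ℕ} {θ : Fin (d + 1) → F}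
    (hθ : IsEigenvalueOrdering q T θ) {μ : F} {v : V} (hv : v ∈ T.eigenspace μ) (h0 : v ≠ 0) :
    ∃ i, θ i = μ :=
  hθ.mem_range (Module.End.hasEigenvalue_of_hasEigenvector ⟨hv, h0⟩)

/-- A weighted sum of the primary idempotents acts on each eigenspace as a scalar. -/
theorem sum_smul_eigenProj_apply (hT : IsDiagonalizable T) {d : ℕ} {θ : Fin (d + 1) → F}
    (hθ : Function.Injective θ) (t : Fin (d + 1) → F) (j : Fin (d + 1)) {v : V}
    (hv : v ∈ T.eigenspace (θ j)) :
    (∑ i, t i • eigenProj hT (θ i)) v = t j • v := by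
  rw [LinearMap.sum_apply, Finset.sum_eq_single j]
  · rw [LinearMap.smul_apply, eigenProj_apply_self hT hv]
  · intro i _ hij
    rw [LinearMap.smul_apply, eigenProj_apply_of_ne hT (fun h => hij (hθ h).symm) hv, smul_zero]
  · simp

/-- The $\theta_i$ exhaust the spectrum, so both factors act as scalars on every eigenspace. With
$s_i=t_i^{-1}$ this inverts $H$. -/
theorem sum_smul_eigenProj_mul {q : F} (hT : IsDiagonalizable T) {d : ℕ} {θ : Fin (d + 1) → F}
    (hθ : IsEigenvalueOrdering q T θ) (s t : Fin (d + 1) → F) (hst : ∀ i, s i * t i = 1) :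
    (∑ i, s i • eigenProj hT (θ i)) * (∑ i, t i • eigenProj hT (θ i)) = 1 := by
  refine hT.hom_ext fun μ v hv => ?_
  by_cases h0 : v = 0
  · simp [h0]
  obtain ⟨j, rfl⟩ := hθ.exists_eq hv h0
  rw [Module.End.mul_apply, sum_smul_eigenProj_apply hT hθ.injective t j hv, map_smul,
    sum_smul_eigenProj_apply hT hθ.injective s j hv, smul_smul, mul_comm, hst, one_smul,
    Module.End.one_apply]

theorem eigenProj_sum_smul_eigenProj_apply {q : F} (hT : IsDiagonalizable T) {d : ℕ}
    {θ : Fin (d + 1) → F} (hθ : IsEigenvalueOrdering q T θ) (t : Fin (d + 1) → F)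
    (i : Fin (d + 1)) (x : V) :
    eigenProj hT (θ i) ((∑ i, t i • eigenProj hT (θ i)) x) = t i • eigenProj hT (θ i) x := by
  have h : eigenProj hT (θ i) * (∑ i, t i • eigenProj hT (θ i)) = t i • eigenProj hT (θ i) := by
    refine hT.hom_ext fun μ v hv => ?_
    by_cases h0 : v = 0
    · simp [h0]
    obtain ⟨j, rfl⟩ := hθ.exists_eq hv h0
    rw [Module.End.mul_apply, sum_smul_eigenProj_apply hT hθ.injective t j hv, map_smul,
      LinearMap.smul_apply]
    by_cases hij : θ j = θ i
    · rw [hθ.injective hij]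
    · rw [eigenProj_apply_of_ne hT hij hv, smul_zero, smul_zero]
  exact LinearMap.congr_fun h x

/-- The block `E_φ Y E_μ` of a solution `Y` of the cubic relation vanishes unless `φ`, `μ` are
equal or adjacent. -/
theorem eigenProj_apply_eq_zero_of_dg {q : F} (hT : IsDiagonalizable T) {Y : Module.End F V}
    (h : dg q T Y = 0) {φ μ : F} (hne : φ ≠ μ) (hadj : ¬ Adjacent q φ μ) {v : V}
    (hv : v ∈ T.eigenspace μ) : eigenProj hT φ (Y v) = 0 := by
  have hTv := Module.End.mem_eigenspace_iff.mp hv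
  have h1 : eigenProj hT φ (dg q T Y v) = 0 := by rw [h]; simp
  simp only [dg, LinearMap.sub_apply, LinearMap.add_apply, LinearMap.smul_apply,
    Module.End.mul_apply, hTv, map_smul, map_sub, map_add, eigenProj_apply_map, smul_smul] at h1
  -- Between the two eigenspaces the cubic relation becomes a scalar, which factors as
  -- $(\varphi-\mu)P(\varphi,\mu)$.
  have h2 : ((φ - μ) * (φ ^ 2 - (q ^ 2 + q⁻¹ ^ 2) * φ * μ + μ ^ 2 + (q ^ 2 - q⁻¹ ^ 2) ^ 2)) •
      eigenProj hT φ (Y v) = 0 := by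
    rw [← h1]
    module
  refine (smul_eq_zero.mp h2).resolve_left fun h3 => ?_
  exact hadj ⟨hne, (mul_eq_zero.mp h3).resolve_left (sub_ne_zero.mpr hne)⟩

/-- On this block $[T,\cdot]_q$ is the scalar $q\varphi-q^{-1}\mu$ and $[T,\cdot]$ is $\varphi-\mu$.
No relation between $T$ and $Y$ is needed. -/
theorem eigenProj_lusztigImage_apply {q : F} (hT : IsDiagonalizable T) (Y : Module.End F V)
    (φ μ : F) {v : V} (hv : v ∈ T.eigenspace μ) :
    eigenProj hT φ (lusztigImage q T Y v) = tPair q φ μ • eigenProj hT φ (Y v) := by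
  have hTv := Module.End.mem_eigenspace_iff.mp hv
  simp only [lusztigImage, qComm, Ring.lie_def, LinearMap.sub_apply, LinearMap.add_apply,
    LinearMap.smul_apply, Module.End.mul_apply, hTv, map_smul, map_sub, map_add,
    eigenProj_apply_map, smul_smul]
  rw [tPair, div_mul_div_comm, ← lusztigScalar, div_eq_mul_inv]
  module

end EigenProj

/-! ### Adjacency of scalars and the weights $t_{ij}$ -/

section Scalars

variable {F : Type*} [Field F] {q : F}

theorem Adjacent.symm {x y : F} (h : Adjacent q x y) : Adjacent q y x :=
  ⟨h.1.symm, by linear_combination h.2⟩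

/-- Two distinct neighbours of `x` sum to `(q² + q⁻²) x`. -/
theorem Adjacent.add_eq {x y z : F} (hy : Adjacent q x y) (hz : Adjacent q x z) (hyz : y ≠ z) :
    y + z = (q ^ 2 + q⁻¹ ^ 2) * x := by
  -- Both $y$ and $z$ are roots of $P(x,\cdot)$; the difference of the two equations is divisible by
  -- $y-z$.
  apply mul_left_cancel₀ (sub_ne_zero.mpr hyz)
  linear_combination hy.2 - hz.2

/-- Every scalar has at most two neighbours. -/
theorem Adjacent.eq_or_eq {x y z w : F} (hy : Adjacent q x y) (hz : Adjacent q x z)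
    (hw : Adjacent q x w) (hyz : y ≠ z) : w = y ∨ w = z := by
  by_contra! h
  exact h.2 (add_left_cancel ((hy.add_eq hw h.1.symm).trans (hy.add_eq hz hyz).symm))

theorem tPair_self (x : F) : tPair q x x = 1 := by simp [tPair]

/-- With $k^{-1}=(q-q^{-1})(q^2-q^{-2})$, expansion gives
$1+k(x-y)^2\bigl(q+q^{-1}+k(x^2-(q^2+q^{-2})xy+y^2)\bigr)$. Adjacency replaces the quadratic by
$-(q^2-q^{-2})^2$, and $k(q^2-q^{-2})^2=q+q^{-1}$. -/
theorem tPair_mul_tPair (hq : q ≠ 0) (hroot : ∀ n : ℕ, 0 < n → q ^ n ≠ 1) {x y : F}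
    (h : Adjacent q x y) : tPair q x y * tPair q y x = 1 := by
  have hk := inv_mul_cancel₀ (lusztigScalar_ne_zero hq hroot)
  have hqr := mul_inv_cancel₀ hq
  have h2 := h.2
  simp only [tPair, div_mul_div_comm]
  rw [← lusztigScalar, div_eq_mul_inv, div_eq_mul_inv]
  generalize (lusztigScalar q)⁻¹ = k at *
  rw [lusztigScalar] at hk
  generalize q⁻¹ = r at *
  linear_combination (x - y) ^ 2 * k ^ 2 * h2 - k * (q + r) * (x - y) ^ 2 * hk +
    (x - y) ^ 2 * k ^ 2 * (x ^ 2 + y ^ 2) * hqr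

theorem tProd_succ {d : ℕ} (θ : Fin (d + 1) → F) (i : Fin d) :
    tProd q θ i.succ = tProd q θ i.castSucc * tPair q (θ i.castSucc) (θ i.succ) := by
  have h : Finset.univ.filter (fun j : Fin d => (j : ℕ) < (i.succ : ℕ)) =
      insert i (Finset.univ.filter (fun j : Fin d => (j : ℕ) < (i.castSucc : ℕ))) := by
    ext j
    simp [Fin.ext_iff, Nat.le_iff_lt_or_eq, or_comm]
  rw [tProd, h, Finset.prod_insert (by simp), mul_comm, tProd]

theorem tProd_ne_zero (hq : q ≠ 0) (hroot : ∀ n : ℕ, 0 < n → q ^ n ≠ 1) {d : ℕ}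
    {θ : Fin (d + 1) → F} (h : ∀ i : Fin d, Adjacent q (θ i.castSucc) (θ i.succ))
    (i : Fin (d + 1)) : tProd q θ i ≠ 0 :=
  Finset.prod_ne_zero_iff.mpr fun j _ =>
    left_ne_zero_of_mul_eq_one (tPair_mul_tPair hq hroot (h j))

/-- A periodic solution of `u (n+2) + u n = (q² + q⁻²) u (n+1)` vanishes. -/
theorem eq_zero_of_periodic_recurrence (hq : q ≠ 0) (hroot : ∀ n : ℕ, 0 < n → q ^ n ≠ 1)
    {u : ℕ → F} {n : ℕ} (hn : 0 < n) (h0 : u n = u 0) (h1 : u (n + 1) = u 1)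
    (hrec : ∀ i < n, u (i + 2) + u i = (q ^ 2 + q⁻¹ ^ 2) * u (i + 1)) : u 0 = 0 ∧ u 1 = 0 := by
  -- If $r$ is a characteristic root, then $u_{i+1}-r^{-1}u_i$ is geometric with ratio $r$.
  -- Periodicity and $r^n\neq1$ make it vanish. The roots $r=q^2$ and $r=q^{-2}$ together force
  -- $u_0=0$.
  have geom : ∀ r : F, r ≠ 0 → (∀ m : ℕ, 0 < m → r ^ m ≠ 1) → q ^ 2 + q⁻¹ ^ 2 = r + r⁻¹ →
      u 1 = r⁻¹ * u 0 := by
    intro r hr hrr hqr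
    have key : ∀ i ≤ n, u (i + 1) - r⁻¹ * u i = r ^ i * (u 1 - r⁻¹ * u 0) := by
      intro i
      induction i with
      | zero => intro _; simp
      | succ i ih =>
        intro hi
        have h2 := hrec i hi
        rw [hqr] at h2
        rw [pow_succ]
        linear_combination h2 + r * ih (by omega) + u i * mul_inv_cancel₀ hr
    have h3 := key n le_rfl
    rw [h0, h1] at h3
    have h4 : (r ^ n - 1) * (u 1 - r⁻¹ * u 0) = 0 := by linear_combination -h3
    exact sub_eq_zero.mp ((mul_eq_zero.mp h4).resolve_left (sub_ne_zero.mpr (hrr n hn)))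
  have hr : ∀ m : ℕ, 0 < m → (q ^ 2) ^ m ≠ 1 := fun m hm => by
    rw [← pow_mul]; exact hroot _ (by omega)
  have ha := geom (q ^ 2) (pow_ne_zero 2 hq) hr (by rw [inv_pow])
  have hb := geom (q ^ 2)⁻¹ (inv_ne_zero (pow_ne_zero 2 hq)) (inv_not_root hr)
    (by rw [inv_inv, inv_pow, add_comm])
  have hb' := hb
  rw [ha, inv_inv] at hb'
  have hc : (q ^ 4 - 1) * u 0 = 0 := by
    field_simp at hb'
    linear_combination -hb'
  have h0 : u 0 = 0 := (mul_eq_zero.mp hc).resolve_left (sub_ne_zero.mpr (hroot 4 (by norm_num)))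
  exact ⟨h0, by rw [hb, h0, mul_zero]⟩

/-- In a path of mutually distinct scalars, only consecutive ones are adjacent. -/
theorem eq_add_one_of_adjacent (hq : q ≠ 0) (hroot : ∀ n : ℕ, 0 < n → q ^ n ≠ 1)
    {d : ℕ} {u : ℕ → F} (hu : ∀ i ≤ d, ∀ j ≤ d, u i = u j → i = j)
    (hadj : ∀ i < d, Adjacent q (u i) (u (i + 1))) {i j : ℕ} (hij : i < j) (hj : j ≤ d)
    (h : Adjacent q (u i) (u j)) : j = i + 1 := by
  by_contra hne
  -- If $i>0$, then $u_i$ already has the two neighbours $u_{i-1},u_{i+1}$, leaving no room for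
  -- $u_j$. Likewise $j<d$ is impossible below.
  have hi0 : i = 0 := by
    by_contra hi
    obtain ⟨k, rfl⟩ := Nat.exists_eq_succ_of_ne_zero hi
    have h1 := (hadj k (by omega)).symm
    have h2 := hadj (k + 1) (by omega)
    rcases h1.eq_or_eq h2 h (fun e => by have := hu _ (by omega) _ (by omega) e; omega) with e | e
    all_goals
      have := hu _ (by omega) _ (by omega) e
      omega
  have hjd : j = d := by
    by_contra hjd
    obtain ⟨k, rfl⟩ : ∃ k, j = k + 1 := ⟨j - 1, by omega⟩
    have h1 := (hadj k (by omega)).symm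
    have h2 := hadj (k + 1) (by omega)
    rcases h1.eq_or_eq h2 h.symm
      (fun e => by have := hu _ (by omega) _ (by omega) e; omega) with e | e
    all_goals
      have := hu _ (by omega) _ (by omega) e
      omega
  subst hi0 hjd
  have hmod : ∀ k ≤ j, u (k % (j + 1)) = u k := fun k hk => by rw [Nat.mod_eq_of_lt (by omega)]
  -- The path closes into a cycle of length $j+1\ge3$. Reading it cyclically, the two neighbours of
  -- each entry are distinct and so satisfy the recurrence; the last two cases are centred at $u_j$
  -- and at $u_0$, where the index wraps around.
  have hz := eq_zero_of_periodic_recurrence hq hroot (u := fun k => u (k % (j + 1)))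
    (n := j + 1) (by omega) (by simp) (by simp [Nat.add_mod_left]) (by
      intro k hk
      rcases Nat.lt_trichotomy (k + 1) j with hk' | hk' | hk'
      · simp only [hmod _ (show k ≤ j by omega), hmod _ (show k + 1 ≤ j by omega),
          hmod _ (show k + 2 ≤ j by omega)]
        exact (hadj (k + 1) hk').add_eq (hadj k (by omega)).symm
          (fun e => by have := hu _ (by omega) _ (by omega) e; omega)
      · simp only [show k + 2 = j + 1 by omega, Nat.mod_self, hmod _ (show k ≤ j by omega),
          hmod _ (show k + 1 ≤ j by omega)]
        rw [hk']
        refine h.symm.add_eq ?_ (fun e => by have := hu _ (by omega) _ (by omega) e; omega)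
        have := (hadj k (by omega)).symm
        rwa [hk'] at this
      · obtain rfl : k = j := by omega
        simp only [show k + 2 = (k + 1) + 1 by omega, Nat.add_mod_left, Nat.mod_self,
          hmod _ (le_refl k), hmod 1 (show 1 ≤ k by omega)]
        exact (hadj 0 (by omega)).add_eq h
          (fun e => by have := hu _ (by omega) _ (by omega) e; omega))
  simp only [hmod 0 (by omega), hmod 1 (by omega)] at hz
  exact (hadj 0 (by omega)).1 (hz.1.trans hz.2.symm)

end Scalars

/-! ### Irreducibility and the existence of the ordering -/

section Connectedness

variable {F : Type*} [Field F] {q : F}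

theorem adjoin_gen_eq_top (q : F) : Algebra.adjoin F (Set.range (gen q)) = ⊤ := by
  rw [eq_top_iff]
  rintro x -
  obtain ⟨y, rfl⟩ := RingQuot.mkAlgHom_surjective F (Rel q) x
  induction y using FreeAlgebra.induction with
  | grade0 r => rw [AlgHom.commutes]; exact Subalgebra.algebraMap_mem _ r
  | grade1 i => exact Algebra.subset_adjoin ⟨i, rfl⟩
  | mul a b ha hb => rw [map_mul]; exact mul_mem ha hb
  | add a b ha hb => rw [map_add]; exact add_mem ha hb

variable {V : Type*} [AddCommGroup V] [Module F V] [Module (Oq q) V] [IsScalarTower F (Oq q) V]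

/-- A subspace stable under both generators is stable under the `q`-Onsager algebra. -/
theorem smul_mem_of_gen_smul_mem {W : Submodule F V}
    (h : ∀ i : Gen, ∀ w ∈ W, gen q i • w ∈ W) (x : Oq q) {w : V} (hw : w ∈ W) : x • w ∈ W := by
  have hx : x ∈ Algebra.adjoin F (Set.range (gen q)) := by rw [adjoin_gen_eq_top]; trivial
  induction hx using Algebra.adjoin_induction generalizing w with
  | mem x hx => obtain ⟨i, rfl⟩ := hx; exact h i w hw
  | algebraMap r => rw [algebraMap_smul]; exact W.smul_mem r hw
  | add x y _ _ hx hy => rw [add_smul]; exact W.add_mem (hx hw) (hy hw)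
  | mul x y _ _ hx hy => rw [mul_smul]; exact hx (hy hw)

/-- The same subspace, over the `q`-Onsager algebra. -/
def oqSubmodule (W : Submodule F V) (h : ∀ i : Gen, ∀ w ∈ W, gen q i • w ∈ W) :
    Submodule (Oq q) V :=
  { W with smul_mem' := fun x _ hw => smul_mem_of_gen_smul_mem h x hw }

theorem dg_act (hq : q ≠ 0) : dg q (act q V (genA q)) (act q V (genAstar q)) = 0 := by
  have h := (dolanGrady_iff hq _ _).mp (dolanGrady_gen q Gen.A Gen.Astar (by simp))
  have h1 := congrArg (act q V) h
  simpa [dg] using h1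

/-- On an irreducible module, the eigenvalues of `A` are connected under adjacency. -/
theorem mem_of_adjacent_closed [IsSimpleModule (Oq q) V] (hq : q ≠ 0)
    (hA : IsDiagonalizable (act q V (genA q))) {S : Set F}
    (hS : ∀ μ ∈ S, ∀ φ, (act q V (genA q)).HasEigenvalue φ → Adjacent q φ μ → φ ∈ S)
    {μ₀ : F} (hμ₀ : μ₀ ∈ S) (he : (act q V (genA q)).HasEigenvalue μ₀)
    {φ : F} (hφ : (act q V (genA q)).HasEigenvalue φ) : φ ∈ S := by
  by_contra hφS
  -- The sum of the eigenspaces indexed by $S$ is stable under $A$, and under $A^*$ because blocks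
  -- of $A^*$ leaving $S$ vanish. Irreducibility makes it all of $V$, which the $\varphi$-eigenspace
  -- contradicts.
  let W : Submodule F V := ⨆ μ ∈ S, (act q V (genA q)).eigenspace μ
  have hker : ∀ w ∈ W, ∀ ν ∉ S, eigenProj hA ν w = 0 := by
    intro w hw ν hν
    have hle : W ≤ LinearMap.ker (eigenProj hA ν) := iSup₂_le fun μ hμ v hv =>
      eigenProj_apply_of_ne hA (fun h : μ = ν => hν (h ▸ hμ)) hv
    exact hle hw
  have hmem : ∀ w : V, (∀ ν ∉ S, eigenProj hA ν w = 0) → w ∈ W := by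
    intro w hw
    have hx : w ∈ ⨆ μ : F, (act q V (genA q)).eigenspace μ := by rw [hA]; trivial
    obtain ⟨f, hf, rfl⟩ := (Submodule.mem_iSup_iff_exists_finsupp _ _).mp hx
    refine Submodule.sum_mem _ fun μ hμ => ?_
    by_cases hμS : μ ∈ S
    · exact Submodule.mem_iSup_of_mem μ (Submodule.mem_iSup_of_mem hμS (hf μ))
    · have h1 := hw μ hμS
      rw [Finsupp.sum, map_sum, Finset.sum_eq_single_of_mem μ hμ
        (fun ν _ hν => eigenProj_apply_of_ne hA hν (hf ν)), eigenProj_apply_self hA (hf μ)] at h1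
      rw [h1]; exact W.zero_mem
  have hstab : ∀ i : Gen, ∀ w ∈ W, gen q i • w ∈ W := by
    intro i w hw
    cases i with
    | A =>
      refine hmem _ fun ν hν => ?_
      have h1 := eigenProj_apply_map hA ν w
      rw [hker w hw ν hν, smul_zero] at h1
      exact h1
    | Astar =>
      have hle : W ≤ W.comap (act q V (genAstar q)) := iSup₂_le fun μ hμ v hv => by
        refine hmem _ fun ν hν => ?_
        by_contra h0
        exact h0 (eigenProj_apply_eq_zero_of_dg hA (dg_act hq) (fun h : ν = μ => hν (h ▸ hμ))
          (fun h => hν (hS μ hμ ν (hasEigenvalue_of_eigenProj_ne_zero hA h0) h)) hv)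
      exact hle hw
  rcases eq_bot_or_eq_top (oqSubmodule W hstab) with h | h
  · obtain ⟨v, hv⟩ := he.exists_hasEigenvector
    have hvW : v ∈ oqSubmodule W hstab :=
      show v ∈ W from Submodule.mem_iSup_of_mem μ₀ (Submodule.mem_iSup_of_mem hμ₀ hv.1)
    rw [h, Submodule.mem_bot] at hvW
    exact hv.2 hvW
  · obtain ⟨v, hv⟩ := hφ.exists_hasEigenvector
    have hvW : v ∈ oqSubmodule W hstab := by rw [h]; trivial
    exact hv.2 ((eigenProj_apply_self hA hv.1).symm.trans (hker v hvW φ hφS))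

/-- The eigenvalues of `A` on an irreducible module form a path under adjacency. -/
theorem exists_isEigenvalueOrdering [IsSimpleModule (Oq q) V] [FiniteDimensional F V]
    (hq : q ≠ 0) (hA : IsDiagonalizable (act q V (genA q))) :
    ∃ (d : ℕ) (θ : Fin (d + 1) → F), IsEigenvalueOrdering q (act q V (genA q)) θ := by
  set T := act q V (genA q)
  have hfin : {μ : F | T.HasEigenvalue μ}.Finite := Module.End.finite_hasEigenvalue T
  -- A longest path of distinct eigenvalues is taken; its vertex set is shown to be closed under
  -- adjacency, hence to be the whole spectrum.
  let P : ℕ → Prop := fun d => ∃ θ : Fin (d + 1) → F, Function.Injective θ ∧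
    (∀ i, T.HasEigenvalue (θ i)) ∧ ∀ i : Fin d, Adjacent q (θ i.castSucc) (θ i.succ)
  have hbound : ∀ d, P d → d ≤ {μ : F | T.HasEigenvalue μ}.ncard := by
    rintro d ⟨θ, hinj, hθ, -⟩
    have h1 := Set.ncard_le_ncard (Set.range_subset_iff.mpr hθ) hfin
    rw [Set.ncard_range_of_injective hinj, Nat.card_fin] at h1
    omega
  have hP0 : P 0 := by
    have : Nontrivial V := IsSimpleModule.nontrivial (Oq q) V
    obtain ⟨v, hv⟩ := exists_ne (0 : V)
    obtain ⟨μ, hμ⟩ : ∃ μ, eigenProj hA μ v ≠ 0 := by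
      by_contra! h
      exact hv (eq_zero_of_eigenProj_eq_zero hA h)
    exact ⟨fun _ => μ, fun i j _ => Subsingleton.elim (α := Fin 1) i j,
      fun _ => hasEigenvalue_of_eigenProj_ne_zero hA hμ, fun i => i.elim0⟩
  classical
  obtain ⟨θ, hinj, hθ, hadj⟩ : P (Nat.findGreatest P {μ : F | T.HasEigenvalue μ}.ncard) :=
    Nat.findGreatest_spec (Nat.zero_le _) hP0
  have hmax : ¬ P (Nat.findGreatest P {μ : F | T.HasEigenvalue μ}.ncard + 1) := fun h =>
    Nat.findGreatest_is_greatest (Nat.lt_succ_self _) (hbound _ h) h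
  generalize Nat.findGreatest P {μ : F | T.HasEigenvalue μ}.ncard = d at *
  refine ⟨d, θ, hinj, ?_, hadj⟩
  refine Set.Subset.antisymm (Set.range_subset_iff.mpr hθ) fun φ hφ => ?_
  refine mem_of_adjacent_closed hq hA ?_ (Set.mem_range_self 0) (hθ 0) hφ
  rintro _ ⟨i, rfl⟩ ψ hψ hψi
  by_contra hψr
  have hne : ∀ k, θ k ≠ ψ := fun k hk => hψr ⟨k, hk⟩
  -- A new neighbour of an end point would lengthen the path; an interior point already has two
  -- neighbours on it.
  by_cases hi0 : i = 0
  · subst hi0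
    refine hmax ⟨Fin.cons ψ θ, Fin.cons_injective_iff.mpr ⟨hψr, hinj⟩, ?_, ?_⟩
    · exact Fin.cases hψ hθ
    · refine Fin.cases ?_ fun k => ?_
      · simpa using hψi
      · simpa using hadj k
  by_cases hil : i = Fin.last d
  · subst hil
    refine hmax ⟨Fin.snoc θ ψ, Fin.snoc_injective_iff.mpr ⟨hinj, hψr⟩, ?_, ?_⟩
    · exact Fin.lastCases (by simpa using hψ) (fun k => by simpa using hθ k)
    · refine Fin.lastCases ?_ fun k => ?_
      · simpa using hψi.symm
      · rw [Fin.snoc_castSucc, Fin.succ_castSucc, Fin.snoc_castSucc]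
        exact hadj k
  obtain ⟨k, rfl⟩ := Fin.exists_succ_eq_of_ne_zero hi0
  obtain ⟨l, hl⟩ := Fin.exists_castSucc_eq.mpr hil
  have h1 := (hadj k).symm
  have h2 := hadj l
  rw [hl] at h2
  have h3 : θ k.castSucc ≠ θ l.succ := fun e => by
    have h4 := Fin.ext_iff.mp (hinj e)
    have h5 := Fin.ext_iff.mp hl
    simp at h4 h5
    omega
  rcases h1.eq_or_eq h2 hψi.symm h3 with e | e
  · exact hne _ e.symm
  · exact hne _ e.symm

end Connectedness

/-! ### Conjugation by $H$ -/

section Conjugation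

variable {F V : Type*} [Field F] [AddCommGroup V] [Module F V] {q : F} {T : Module.End F V}

/-- In an ordering of the eigenvalues, adjacent eigenvalues are consecutive. -/
theorem IsEigenvalueOrdering.eq_succ_of_adjacent (hq : q ≠ 0)
    (hroot : ∀ n : ℕ, 0 < n → q ^ n ≠ 1) {d : ℕ} {θ : Fin (d + 1) → F}
    (hθ : IsEigenvalueOrdering q T θ) {i j : Fin (d + 1)} (hij : i < j)
    (h : Adjacent q (θ i) (θ j)) : ∃ k : Fin d, i = k.castSucc ∧ j = k.succ := by
  have hi : (i : ℕ) < d := by have := j.is_lt; have : (i : ℕ) < j := hij; omega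
  -- The padding value 0 plays no role, since only indices up to $d$ are compared.
  let u : ℕ → F := fun n => if hn : n < d + 1 then θ ⟨n, hn⟩ else 0
  have hu : ∀ n (hn : n < d + 1), u n = θ ⟨n, hn⟩ := fun n hn => dif_pos hn
  have key := eq_add_one_of_adjacent hq hroot (d := d) (u := u) (i := i) (j := j)
    (fun m hm n hn e => by
      rw [hu m (by omega), hu n (by omega)] at e
      exact Fin.mk.inj (hθ.injective e))
    (fun n hn => by
      rw [hu n (by omega), hu (n + 1) (by omega)]
      exact hθ.adjacent ⟨n, hn⟩)
    hij (by omega) (by rw [hu _ i.is_lt, hu _ j.is_lt]; exact h)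
  exact ⟨⟨i, hi⟩, rfl, Fin.ext key⟩

/-- Adjacent indices differ by one. A step forward appends a factor to the product; a step back
cancels one, by $t_{ij}t_{ji}=1$. -/
theorem IsEigenvalueOrdering.tProd_mul_tPair (hq : q ≠ 0)
    (hroot : ∀ n : ℕ, 0 < n → q ^ n ≠ 1) {d : ℕ} {θ : Fin (d + 1) → F}
    (hθ : IsEigenvalueOrdering q T θ) {i j : Fin (d + 1)}
    (h : Adjacent q (θ i) (θ j)) :
    tProd q θ i * tPair q (θ i) (θ j) = tProd q θ j := by
  have hij : i ≠ j := fun e => h.1 (e ▸ rfl)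
  rcases lt_or_gt_of_ne hij with hij | hij
  · obtain ⟨k, rfl, rfl⟩ := hθ.eq_succ_of_adjacent hq hroot hij h
    exact (tProd_succ θ k).symm
  · obtain ⟨k, rfl, rfl⟩ := hθ.eq_succ_of_adjacent hq hroot hij h.symm
    rw [tProd_succ, mul_assoc, tPair_mul_tPair hq hroot h.symm, mul_one]

/-- The $(i,j)$ block of the left side is $t_it_{ij}E_iYE_j$ and that of the right side is
$t_jE_iYE_j$. These agree on the diagonal since $t_{ii}=1$, at adjacent pairs by `tProd_mul_tPair`,
and elsewhere since the block is zero. -/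
theorem mapH_mul_lusztigImage (hq : q ≠ 0) (hroot : ∀ n : ℕ, 0 < n → q ^ n ≠ 1)
    (hT : IsDiagonalizable T) {d : ℕ} {θ : Fin (d + 1) → F} (hθ : IsEigenvalueOrdering q T θ)
    {Y : Module.End F V} (h : dg q T Y = 0) :
    mapH q hT θ * lusztigImage q T Y = Y * mapH q hT θ := by
  refine hT.hom_ext fun μ v hv => ?_
  by_cases h0 : v = 0
  · simp [h0]
  obtain ⟨j, rfl⟩ := hθ.exists_eq hv h0
  rw [Module.End.mul_apply, Module.End.mul_apply, mapH,
    sum_smul_eigenProj_apply hT hθ.injective _ j hv, map_smul]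
  refine ext_eigenProj hT fun φ => ?_
  by_cases hφ : T.HasEigenvalue φ
  · obtain ⟨i, rfl⟩ := hθ.mem_range hφ
    rw [eigenProj_sum_smul_eigenProj_apply hT hθ, eigenProj_lusztigImage_apply hT Y _ _ hv,
      map_smul, smul_smul]
    by_cases hij : θ i = θ j
    · rw [hθ.injective hij, tPair_self, mul_one]
    by_cases hadj : Adjacent q (θ i) (θ j)
    · rw [hθ.tProd_mul_tPair hq hroot hadj]
    · rw [eigenProj_apply_eq_zero_of_dg hT h hij hadj hv, smul_zero, smul_zero]
  · have hz : ∀ x, eigenProj hT φ x = 0 := fun x => by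
      by_contra hx
      exact hφ (hasEigenvalue_of_eigenProj_ne_zero hT hx)
    rw [hz, hz]

theorem mapH_mul_self (hT : IsDiagonalizable T) {d : ℕ} {θ : Fin (d + 1) → F}
    (hθ : IsEigenvalueOrdering q T θ) : mapH q hT θ * T = T * mapH q hT θ := by
  refine hT.hom_ext fun μ v hv => ?_
  by_cases h0 : v = 0
  · simp [h0]
  obtain ⟨j, rfl⟩ := hθ.exists_eq hv h0
  have hTv := Module.End.mem_eigenspace_iff.mp hv
  rw [Module.End.mul_apply, Module.End.mul_apply, mapH, hTv, map_smul,
    sum_smul_eigenProj_apply hT hθ.injective _ j hv, map_smul, hTv, smul_comm]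

/-- The map `H` as a unit. -/
noncomputable def unitH (hq : q ≠ 0) (hroot : ∀ n : ℕ, 0 < n → q ^ n ≠ 1)
    (hT : IsDiagonalizable T) {d : ℕ} {θ : Fin (d + 1) → F} (hθ : IsEigenvalueOrdering q T θ) :
    (Module.End F V)ˣ where
  val := mapH q hT θ
  inv := ∑ i, (tProd q θ i)⁻¹ • eigenProj hT (θ i)
  val_inv := sum_smul_eigenProj_mul hT hθ _ _ fun i =>
    mul_inv_cancel₀ (tProd_ne_zero hq hroot hθ.adjacent i)
  inv_val := sum_smul_eigenProj_mul hT hθ _ _ fun i =>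
    inv_mul_cancel₀ (tProd_ne_zero hq hroot hθ.adjacent i)

end Conjugation

/-- Conjugation by `H` implements the Lusztig automorphism. -/
theorem mapH_mul_act_lusztig {F : Type*} [Field F] {q : F} (hq : q ≠ 0)
    (hroot : ∀ n : ℕ, 0 < n → q ^ n ≠ 1)
    {V : Type*} [AddCommGroup V] [Module F V] [Module (Oq q) V] [IsScalarTower F (Oq q) V]
    (hA : IsDiagonalizable (act q V (genA q))) {d : ℕ} {θ : Fin (d + 1) → F}
    (hθ : IsEigenvalueOrdering q (act q V (genA q)) θ) (X : Oq q) :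
    mapH q hA θ * act q V (lusztig q hq hroot X) = act q V X * mapH q hA θ := by
  -- The intertwining relation passes to products, $HL(X)L(Y)=XHL(Y)=XYH$, so the generators
  -- suffice.
  have hX : X ∈ Algebra.adjoin F (Set.range (gen q)) := by rw [adjoin_gen_eq_top]; trivial
  induction hX using Algebra.adjoin_induction with
  | mem X hX =>
    obtain ⟨i, rfl⟩ := hX
    cases i with
    | A => rw [lusztig_genA]; exact mapH_mul_self hA hθ
    | Astar =>
      have h := map_lusztigImage (act q V) q (genA q) (genAstar q)
      rw [lusztig_genAstar, ← lusztigScalar, ← lusztigImage, h]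
      exact mapH_mul_lusztigImage hq hroot hA hθ (dg_act hq)
  | algebraMap r =>
    rw [AlgEquiv.commutes, AlgHom.commutes]
    exact (Algebra.commutes r _).symm
  | add X Y _ _ hX hY => rw [map_add, map_add, mul_add, hX, hY, map_add, add_mul]
  | mul X Y _ _ hX hY =>
    rw [map_mul, map_mul, ← mul_assoc, hX, mul_assoc, hY, ← mul_assoc, map_mul]

end QOnsager

theorem proposition3p8 {F : Type*} [Field F] (q : F) (hq : q ≠ 0)
    (hroot : ∀ n : ℕ, 0 < n → q ^ n ≠ 1)
    {V : Type*} [AddCommGroup V] [Module F V] [Module (QOnsager.Oq q) V]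
    [IsScalarTower F (QOnsager.Oq q) V]
    [IsSimpleModule (QOnsager.Oq q) V] [FiniteDimensional F V]
    (hdim : 2 ≤ Module.finrank F V)
    (hA : QOnsager.IsDiagonalizable (QOnsager.act q V (QOnsager.genA q)))
    (hAstar : QOnsager.IsDiagonalizable (QOnsager.act q V (QOnsager.genAstar q))) :
    (∃ (d : ℕ) (θ : Fin (d + 1) → F),
      QOnsager.IsEigenvalueOrdering q (QOnsager.act q V (QOnsager.genA q)) θ) ∧
    ∀ (d : ℕ) (θ : Fin (d + 1) → F),
      QOnsager.IsEigenvalueOrdering q (QOnsager.act q V (QOnsager.genA q)) θ →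
      ∃ H : (Module.End F V)ˣ,
        (H : Module.End F V) = QOnsager.mapH q hA θ ∧
        ∀ X : QOnsager.Oq q,
          QOnsager.act q V (QOnsager.lusztig q hq hroot X) =
            (↑H⁻¹ : Module.End F V) * QOnsager.act q V X * (H : Module.End F V) ∧
          QOnsager.act q V ((QOnsager.lusztig q hq hroot).symm X) =
            (H : Module.End F V) * QOnsager.act q V X * (↑H⁻¹ : Module.End F V) := by
  refine ⟨QOnsager.exists_isEigenvalueOrdering hq hA, fun d θ hθ =>
    ⟨QOnsager.unitH hq hroot hA hθ, rfl, fun X => ⟨?_, ?_⟩⟩⟩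
  · rw [mul_assoc, Units.eq_inv_mul_iff_mul_eq]
    exact QOnsager.mapH_mul_act_lusztig hq hroot hA hθ X
  · rw [Units.eq_mul_inv_iff_mul_eq]
    -- The intertwining relation at $L^{-1}(X)$ reads $HX=L^{-1}(X)H$.
    have h := QOnsager.mapH_mul_act_lusztig hq hroot hA hθ ((QOnsager.lusztig q hq hroot).symm X)
    rw [AlgEquiv.apply_symm_apply] at h
    exact h.symm
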